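/- Let $(R,\mathfrak m)$ be a Noetherian Cohen–Macaulay local ring of dimension one with infinite residue field, and let $I\subset R$ be an $\mathfrak m$-primary ideal, with integral closure $\bar I$. Let $e_0(I),e_1(I)$ be the Hilbert coefficients of $I$, i.e. the unique integers such that the length of $R/I^{n+1}$ equals $e_0(I)(n+1)-e_1(I)$ for all large $n$. Let $k\ge 1$ be an integer and suppose that there exist distinct integrally closed ideals $J_1,\dots,J_{k-1}$ of $R$ such that $\mathfrak m\supsetneq J_{k-1}\supseteq J_{k-2}\supseteq\cdots\supseteq J_1\supsetneq\bar I$ (for $k=1$ this condition reads $\mathfrak m\supsetneq\bar I$). Then $$e_1(I)\le\binom{e_0(I)-k}{2},$$ and if $I$ is not integrally closed, then $$e_1(I)<\binom{e_0(I)-k}{2}.$$ -/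

import Mathlib

namespace HilbertCoeff

open Polynomial IsLocalRing

section IntegralClosure

variable {R : Type*} [CommRing R]

/-- `x` is integral over the ideal `I`: it satisfies an equation
`x ^ n + a₁ x ^ (n - 1) + ⋯ + aₙ = 0` with `n ≥ 1` and `aᵢ ∈ I ^ i`. -/
def IsIntegralOverIdeal (I : Ideal R) (x : R) : Prop :=
  ∃ n : ℕ, 0 < n ∧ ∃ a : ℕ → R, (∀ i, a i ∈ I ^ i) ∧
    x ^ n + ∑ i ∈ Finset.Icc 1 n, a i * x ^ (n - i) = 0

/-- `x` is integral over `I` iff `x T` is integral over the Rees algebra `R[I T]` in `R[T]`. -/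
theorem isIntegralOverIdeal_iff (I : Ideal R) (x : R) :
    IsIntegralOverIdeal I x ↔ IsIntegral (reesAlgebra I) (monomial 1 x : R[X]) := by
  constructor
  · rintro ⟨n, hn, a, ha, h⟩
    nontriviality R
    refine ⟨X ^ n + ∑ i ∈ Finset.Icc 1 n,
      C (⟨monomial i (a i), reesAlgebra.monomial_mem.2 (ha i)⟩ : reesAlgebra I) * X ^ (n - i),
      monic_X_pow_add ?_, ?_⟩
    · refine lt_of_le_of_lt (degree_sum_le _ _) ?_
      refine (Finset.sup_lt_iff (WithBot.bot_lt_coe n)).2 ?_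
      intro i hi
      refine lt_of_le_of_lt (degree_C_mul_X_pow_le _ _) ?_
      rw [Finset.mem_Icc] at hi
      exact WithBot.coe_lt_coe.2 (by omega : n - i < n)
    · rw [eval₂_add, eval₂_finsetSum, eval₂_X_pow]
      have key : ∀ i ∈ Finset.Icc 1 n,
          eval₂ (algebraMap (reesAlgebra I) R[X]) (monomial 1 x)
            (C (⟨monomial i (a i), reesAlgebra.monomial_mem.2 (ha i)⟩ : reesAlgebra I) *
              X ^ (n - i)) = monomial n (a i * x ^ (n - i)) := by
        intro i hi
        rw [Finset.mem_Icc] at hi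
        rw [eval₂_mul, eval₂_C, eval₂_X_pow, monomial_pow]
        change monomial i (a i) * _ = _
        rw [monomial_mul_monomial]
        rw [show i + 1 * (n - i) = n by omega]
      rw [Finset.sum_congr rfl key, monomial_pow, one_mul, ← map_sum, ← map_add, h, map_zero]
  · rintro ⟨p, hp, h⟩
    rcases subsingleton_or_nontrivial R with hR | hR
    · exact ⟨1, one_pos, fun _ => 0, fun _ => zero_mem _, Subsingleton.elim _ _⟩
    have hn : 0 < p.natDegree := by
      rcases Nat.eq_zero_or_pos p.natDegree with h0 | h0
      · rw [hp.natDegree_eq_zero.1 h0] at h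
        simp at h
      · exact h0
    refine ⟨p.natDegree, hn, fun i => if i ≤ p.natDegree then
      (p.coeff (p.natDegree - i) : R[X]).coeff i else 0, ?_, ?_⟩
    · intro i
      dsimp only
      split_ifs
      · exact (p.coeff (p.natDegree - i)).2 i
      · exact zero_mem _
    · have h1 := congrArg (fun q : R[X] => q.coeff p.natDegree) h
      simp only [eval₂_eq_sum_range, finsetSum_coeff, coeff_zero] at h1
      rw [Finset.sum_range_succ, add_comm] at h1
      have hT : ∀ i, i ≤ p.natDegree →
          ((algebraMap (reesAlgebra I) R[X]) (p.coeff i) * monomial 1 x ^ i).coeff p.natDegree =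
          (p.coeff i : R[X]).coeff (p.natDegree - i) * x ^ i := by
        intro i hi
        rw [monomial_pow, one_mul]
        change ((p.coeff i : R[X]) * _).coeff _ = _
        conv_lhs => rw [show p.natDegree = (p.natDegree - i) + i by omega]
        rw [coeff_mul_monomial]
      rw [hT _ le_rfl, hp.coeff_natDegree] at h1
      refine Eq.trans ?_ h1
      congr 1
      · simp
      · refine Finset.sum_nbij' (fun i => p.natDegree - i) (fun i => p.natDegree - i)
          ?_ ?_ ?_ ?_ ?_
        · intro i hi
          simp only [Finset.mem_Icc, Finset.mem_range] at *
          omega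
        · intro i hi
          simp only [Finset.mem_Icc, Finset.mem_range] at *
          omega
        · intro i hi
          simp only [Finset.mem_Icc] at *
          omega
        · intro i hi
          simp only [Finset.mem_range] at *
          omega
        · intro i hi
          rw [Finset.mem_Icc] at hi
          simp only [hT _ (Nat.sub_le _ _), if_pos hi.2, Nat.sub_sub_self hi.2]

/-- The integral closure of the ideal `I`, the ideal of all elements integral over `I`. -/
def idealIntegralClosure (I : Ideal R) : Ideal R where
  carrier := {x | IsIntegralOverIdeal I x}
  zero_mem' := by
    change IsIntegralOverIdeal I 0
    rw [isIntegralOverIdeal_iff, map_zero]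
    exact isIntegral_zero
  add_mem' := by
    intro x y hx hy
    change IsIntegralOverIdeal I x at hx
    change IsIntegralOverIdeal I y at hy
    change IsIntegralOverIdeal I (x + y)
    rw [isIntegralOverIdeal_iff] at *
    rw [map_add]
    exact hx.add hy
  smul_mem' := by
    intro c x hx
    change IsIntegralOverIdeal I x at hx
    change IsIntegralOverIdeal I (c * x)
    rw [isIntegralOverIdeal_iff] at *
    have h : (monomial 1 (c * x) : R[X]) = algebraMap (reesAlgebra I) R[X]
        (algebraMap R (reesAlgebra I) c) * monomial 1 x := by
      change _ = C c * monomial 1 x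
      rw [C_mul_monomial]
    rw [h]
    exact isIntegral_algebraMap.mul hx

/-- An ideal is integrally closed if it equals its integral closure. -/
def IsIntegrallyClosedIdeal (I : Ideal R) : Prop :=
  idealIntegralClosure I = I

end IntegralClosure

section Local

variable (R : Type*) [CommRing R] [IsLocalRing R]

/-- The Cohen–Macaulay property of a Noetherian local ring: its depth equals its dimension, that is,
the maximal ideal contains an `R`-regular sequence of length `dim R`. -/
def IsCohenMacaulayLocal : Prop :=
  ∃ rs : List R, (∀ r ∈ rs, r ∈ maximalIdeal R) ∧ RingTheory.Sequence.IsRegular R rs ∧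
    (rs.length : WithBot ℕ∞) = ringKrullDim R

variable {R}

/-- `I` is primary with radical the maximal ideal. -/
def IsMaximalPrimary (I : Ideal R) : Prop :=
  I.IsPrimary ∧ I.radical = maximalIdeal R

end Local

/-- The integers `e 0, …, e d` are the Hilbert coefficients of `I` (with `d = dim R`): for all large
`n` the length of `R / I ^ (n + 1)` is finite and equals `∑ j, (-1) ^ j e_j C(n + d - j, d - j)`. -/
def IsHilbertCoefficients {R : Type*} [CommRing R] (I : Ideal R) (d : ℕ) (e : Fin (d + 1) → ℤ) :
    Prop :=
  ∀ᶠ n : ℕ in Filter.atTop, ∃ l : ℕ, Module.length R (R ⧸ I ^ (n + 1)) = (l : ℕ∞) ∧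
    (l : ℤ) = ∑ j : Fin (d + 1), (-1) ^ (j : ℕ) * e j * ((n + d - j).choose (d - j) : ℤ)

end HilbertCoeff

/-! Write λ for length. The infinite residue field gives a regular x in I with I^(s+1) = xI^s for
some s; let r be the least such s and c = λ(R/x). Multiplication by x shows λ(I^n/I^(n+1)) = c for n
≥ r, so e_0 = c and e_1 = rc - λ(R/I^r). An upper bound for e_1 is therefore a lower bound for
λ(R/I^r).

For n ≤ r one has λ(I^n/I^(n+1)) ≥ n + 1 + k, from two sources. First, I^n needs at least n + 1
generators: modulo 𝔪I^n the images of x^(n-j)I^j grow strictly with j, since a stall at j = i < n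
would force I^(i+1) = xI^i (`pow_succ_eq_of_span_mul_le_sup`). Second, the k strict inclusions from
the integral closure of I up to 𝔪 stay strict after multiplication by I^n, by the determinant trick
(`IsIntegrallyClosedIdeal.mul_lt_mul`).

Summing over n < r gives e_1 ≤ rE - r(r+1)/2 with E = c - k. This falls short of E(E-1)/2 by
(E-r)(E-r-1)/2, which is nonnegative as half a product of consecutive integers. If I is not
integrally closed, λ(R/I) gains one more unit, and the inequality is strict. -/

namespace HilbertCoeff

open Polynomial IsLocalRing

/-! ### Lengths of quotients by ideals -/

section Colength

variable {R : Type*} [CommRing R]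

/-- The length of `R / J`, as a natural number (zero if the length is infinite). -/
noncomputable def colength (J : Ideal R) : ℕ := (Module.length R (R ⧸ J)).toNat

/-- The quotient `R / J` has finite length. -/
def FiniteColength (J : Ideal R) : Prop := Module.length R (R ⧸ J) ≠ ⊤

theorem FiniteColength.coe_colength {J : Ideal R} (h : FiniteColength J) :
    (colength J : ℕ∞) = Module.length R (R ⧸ J) :=
  ENat.natCast_toNat h

theorem FiniteColength.mono {A B : Ideal R} (hAB : A ≤ B) (hA : FiniteColength A) :
    FiniteColength B := by
  unfold FiniteColength at *
  rw [Module.length_quotient] at *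
  exact ne_top_of_le_ne_top hA (Order.coheight_anti hAB)

theorem FiniteColength.colength_le {A B : Ideal R} (hA : FiniteColength A) (hAB : A ≤ B) :
    colength B ≤ colength A := by
  have h : (colength B : ℕ∞) ≤ colength A := by
    rw [hA.coe_colength, (hA.mono hAB).coe_colength, Module.length_quotient,
      Module.length_quotient]
    exact Order.coheight_anti hAB
  exact_mod_cast h

theorem FiniteColength.colength_lt {A B : Ideal R} (hA : FiniteColength A) (hAB : A < B) :
    colength B < colength A := by
  have hB := hA.mono hAB.le
  have h : (colength B : ℕ∞) < colength A := by
    rw [hA.coe_colength, hB.coe_colength, Module.length_quotient, Module.length_quotient]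
    refine Order.coheight_strictAnti hAB ?_
    rw [← Module.length_quotient]
    exact lt_top_iff_ne_top.2 hB
  exact_mod_cast h

theorem FiniteColength.colength_add_le {f : ℕ → Ideal R} (h0 : FiniteColength (f 0)) {p : ℕ}
    (hf : ∀ i < p, f i < f (i + 1)) :
    FiniteColength (f p) ∧ colength (f p) + p ≤ colength (f 0) := by
  induction p with
  | zero => exact ⟨h0, le_rfl⟩
  | succ p ih =>
    obtain ⟨h1, h2⟩ := ih fun i hi => hf i (by omega)
    have h3 := h1.colength_lt (hf p (by omega))
    exact ⟨h1.mono (hf p (by omega)).le, by omega⟩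

/-- Multiplication by the regular element x gives the exact sequence 0 → R/J → R/xJ → R/x → 0. -/
theorem length_quotient_span_mul {x : R} (hx : x ∈ nonZeroDivisors R) (J : Ideal R) :
    Module.length R (R ⧸ Ideal.span {x} * J) =
      Module.length R (R ⧸ J) + Module.length R (R ⧸ Ideal.span {x}) := by
  have hle : Ideal.span {x} * J ≤ Ideal.span {x} := Ideal.mul_le_left
  have hcomap : J ≤ Submodule.comap (LinearMap.mulLeft R x) (Ideal.span {x} * J) := by
    intro y hy
    exact Ideal.mul_mem_mul (Ideal.mem_span_singleton_self x) hy
  refine Module.length_eq_add_of_exact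
    (Submodule.mapQ J (Ideal.span {x} * J) (LinearMap.mulLeft R x) hcomap)
    (Submodule.factor hle) ?_ (Submodule.factor_surjective hle) ?_
  · rw [← LinearMap.ker_eq_bot, LinearMap.ker_eq_bot']
    intro y hy
    obtain ⟨y, rfl⟩ := Submodule.Quotient.mk_surjective _ y
    rw [Submodule.mapQ_apply, Submodule.Quotient.mk_eq_zero] at hy
    obtain ⟨z, hz, hzy⟩ := Ideal.mem_span_singleton_mul.1 hy
    rw [Submodule.Quotient.mk_eq_zero]
    rw [LinearMap.mulLeft_apply, mul_cancel_left_mem_nonZeroDivisors hx] at hzy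
    exact hzy ▸ hz
  · intro y
    obtain ⟨y, rfl⟩ := Submodule.Quotient.mk_surjective _ y
    constructor
    · intro hy
      have hy' : y ∈ Ideal.span {x} := by
        rwa [← Submodule.Quotient.mk_eq_zero]
      obtain ⟨z, rfl⟩ := Ideal.mem_span_singleton'.1 hy'
      exact ⟨Submodule.Quotient.mk z, by
        rw [Submodule.mapQ_apply, LinearMap.mulLeft_apply, mul_comm x z]⟩
    · rintro ⟨z, hz⟩
      obtain ⟨z, rfl⟩ := Submodule.Quotient.mk_surjective _ z
      rw [← hz, Submodule.mapQ_apply, LinearMap.mulLeft_apply]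
      change Submodule.Quotient.mk (x * z) = _
      rw [Submodule.Quotient.mk_eq_zero]
      exact Ideal.mul_mem_right _ _ (Ideal.mem_span_singleton_self x)

theorem FiniteColength.span_mul {x : R} (hx : x ∈ nonZeroDivisors R)
    (hfx : FiniteColength (Ideal.span {x})) {J : Ideal R} (hJ : FiniteColength J) :
    FiniteColength (Ideal.span {x} * J) := by
  unfold FiniteColength at *
  rw [length_quotient_span_mul hx]
  exact WithTop.add_ne_top.2 ⟨hJ, hfx⟩

theorem colength_span_mul {x : R} (hx : x ∈ nonZeroDivisors R)
    (hfx : FiniteColength (Ideal.span {x})) {J : Ideal R} (hJ : FiniteColength J) :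
    colength (Ideal.span {x} * J) = colength J + colength (Ideal.span {x}) := by
  have h : (colength (Ideal.span {x} * J) : ℕ∞) = colength J + colength (Ideal.span {x}) := by
    rw [(hfx.span_mul hx hJ).coe_colength, hJ.coe_colength, hfx.coe_colength,
      length_quotient_span_mul hx]
  exact_mod_cast h

theorem finiteColength_of_isArtinianRing {J : Ideal R} (h : IsArtinianRing (R ⧸ J)) :
    FiniteColength J := by
  unfold FiniteColength
  rw [Module.length_eq_of_surjective (R := R ⧸ J) (S := R) (M := R ⧸ J)
    Ideal.Quotient.mk_surjective]
  exact Module.length_ne_top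

theorem finiteColength_of_maximalIdeal_pow_le [IsNoetherianRing R] [IsLocalRing R]
    {J : Ideal R} {p : ℕ} (h : maximalIdeal R ^ p ≤ J) : FiniteColength J := by
  by_cases hJ : J = ⊤
  · subst hJ
    unfold FiniteColength
    simp [Module.length_eq_zero]
  · have : Nontrivial (R ⧸ J) := Ideal.Quotient.nontrivial_iff.mpr hJ
    have := IsLocalRing.of_surjective' (Ideal.Quotient.mk J) Ideal.Quotient.mk_surjective
    have := IsLocalHom.of_surjective (Ideal.Quotient.mk J) Ideal.Quotient.mk_surjective
    refine finiteColength_of_isArtinianRing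
      ((isArtinianRing_iff_isNilpotent_maximalIdeal _).2 ⟨p, ?_⟩)
    have hmap : (maximalIdeal R).map (Ideal.Quotient.mk J) = maximalIdeal (R ⧸ J) := by
      ext x
      obtain ⟨x, rfl⟩ := Ideal.Quotient.mk_surjective x
      simp [sup_eq_left.mpr (le_maximalIdeal hJ)]
    rwa [← hmap, ← Ideal.map_pow, Ideal.zero_eq_bot, Ideal.map_eq_bot_iff_le_ker,
      Ideal.mk_ker]

end Colength

/-! ### Integral closure and cancellation -/

section Integral

variable {R : Type*} [CommRing R]

theorem le_idealIntegralClosure (I : Ideal R) : I ≤ idealIntegralClosure I := by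
  intro x hx
  change IsIntegralOverIdeal I x
  rw [isIntegralOverIdeal_iff]
  exact isIntegral_algebraMap (R := reesAlgebra I) (A := R[X])
    (x := ⟨monomial 1 x, reesAlgebra.monomial_mem.2 (by simpa using hx)⟩)

/-- Integral closure of ideals is idempotent. -/
theorem isIntegrallyClosedIdeal_idealIntegralClosure (I : Ideal R) :
    IsIntegrallyClosedIdeal (idealIntegralClosure I) := by
  refine le_antisymm ?_ (le_idealIntegralClosure _)
  intro x hx
  change IsIntegralOverIdeal _ x at hx
  change IsIntegralOverIdeal _ x
  rw [isIntegralOverIdeal_iff] at *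
  -- The Rees algebra of the closure is generated over R by elements zT integral over `reesAlgebra
  -- I`, so transitivity of integrality applies.
  have hle : ∀ y ∈ reesAlgebra (idealIntegralClosure I), IsIntegral (reesAlgebra I) y := by
    intro y hy
    rw [← adjoin_monomial_eq_reesAlgebra] at hy
    have : Algebra.adjoin R (Submodule.map (monomial 1 : R →ₗ[R] R[X])
        (idealIntegralClosure I) : Set R[X]) ≤
        (integralClosure (reesAlgebra I) R[X]).restrictScalars R := by
      refine Algebra.adjoin_le ?_
      rintro _ ⟨z, hz, rfl⟩
      exact (isIntegralOverIdeal_iff I z).1 hz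
    exact this hy
  obtain ⟨p, hp, hpx⟩ := hx
  refine isIntegral_trans (R := reesAlgebra I) (A := integralClosure (reesAlgebra I) R[X])
    (B := R[X]) (monomial 1 x) ?_
  let φ : reesAlgebra (idealIntegralClosure I) →+* integralClosure (reesAlgebra I) R[X] :=
    (reesAlgebra (idealIntegralClosure I)).val.toRingHom.codRestrict
      (integralClosure (reesAlgebra I) R[X]) fun y => hle y y.2
  refine ⟨p.map φ, hp.map φ, ?_⟩
  rw [eval₂_map]
  exact hpx

/-- The determinant trick: a multiplier of `L` into `A L` is integral over `A`. -/
theorem isIntegralOverIdeal_of_mul_le [Nontrivial R] {A L : Ideal R} (hL : L.FG) {a : R}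
    (haL : a ∈ L) (ha : a ∈ nonZeroDivisors R) {b : R} (hb : ∀ l ∈ L, b * l ∈ A * L) :
    IsIntegralOverIdeal A b := by
  have : Module.Finite R L := Module.Finite.iff_fg.2 hL
  obtain ⟨p, hp, -, hc, h0⟩ :=
    LinearMap.exists_monic_and_natDegree_eq_and_coeff_mem_pow_and_aeval_eq_zero R
      (algebraMap R (Module.End R L) b) A (by
        rintro _ ⟨l, rfl⟩
        have h1 := hb l l.2
        have h2 : Submodule.map L.subtype (A • (⊤ : Submodule R L)) = A * L := by
          rw [Submodule.map_smul'', Submodule.map_top, Submodule.range_subtype, smul_eq_mul]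
        rw [← h2] at h1
        obtain ⟨y, hy, hyl⟩ := h1
        have h3 : algebraMap R (Module.End R L) b l = y := Subtype.ext hyl.symm
        rw [h3]
        exact hy)
  -- The polynomial annihilates multiplication by b on L; applying it to the regular element a of L
  -- and cancelling a gives p(b) = 0.
  have hpb : p.eval b = 0 := by
    rw [aeval_algebraMap_apply] at h0
    have h1 := congrArg (fun f : Module.End R L => ((f ⟨a, haL⟩ : L) : R)) h0
    have h2 : p.eval b * a = 0 := by simpa using h1
    exact (mul_right_mem_nonZeroDivisors_eq_zero_iff ha).1 h2
  have hn : 0 < p.natDegree := by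
    rcases Nat.eq_zero_or_pos p.natDegree with h | h
    · rw [hp.natDegree_eq_zero.1 h] at hpb
      simp at hpb
    · exact h
  refine ⟨p.natDegree, hn, fun i => if i ≤ p.natDegree then p.coeff (p.natDegree - i) else 0,
    ?_, ?_⟩
  · intro i
    dsimp only
    split_ifs with hi
    · have := hc (p.natDegree - i)
      rwa [Nat.sub_sub_self hi] at this
    · exact zero_mem _
  · rw [eval_eq_sum_range, Finset.sum_range_succ, add_comm, hp.coeff_natDegree, one_mul] at hpb
    refine Eq.trans ?_ hpb
    congr 1
    refine Finset.sum_nbij' (fun i => p.natDegree - i) (fun i => p.natDegree - i) ?_ ?_ ?_ ?_ ?_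
    · intro i hi
      simp only [Finset.mem_Icc, Finset.mem_range] at *
      omega
    · intro i hi
      simp only [Finset.mem_Icc, Finset.mem_range] at *
      omega
    · intro i hi
      simp only [Finset.mem_Icc] at *
      omega
    · intro i hi
      simp only [Finset.mem_range] at *
      omega
    · intro i hi
      rw [Finset.mem_Icc] at hi
      simp only [if_pos hi.2]

/-- Cancellation for integrally closed ideals. -/
theorem IsIntegrallyClosedIdeal.mul_lt_mul [Nontrivial R] {A B L : Ideal R}
    (hA : IsIntegrallyClosedIdeal A) (hL : L.FG) {a : R} (haL : a ∈ L)
    (ha : a ∈ nonZeroDivisors R) (hAB : A < B) : A * L < B * L := by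
  refine lt_of_le_of_ne (Ideal.mul_mono_left hAB.le) fun h => hAB.not_ge fun b hb => ?_
  rw [← hA]
  exact isIntegralOverIdeal_of_mul_le hL haL ha fun l hl => h ▸ Ideal.mul_mem_mul hb hl

end Integral

/-! ### Existence of principal reductions -/

section Reduction

variable {R : Type*} [CommRing R]

/-- In the expansion of (A + (y))^(n+1) only y^(n+1) has no factor in A. Testing whether A is a
reduction thus comes down to a single power of y. -/
theorem pow_succ_le_mul_pow_sup_span (A I : Ideal R) {y : R} (hy : y ∈ I) (hI : I ≤ A ⊔ Ideal.span {y})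
    (n : ℕ) : I ^ (n + 1) ≤ A * I ^ n ⊔ Ideal.span {y ^ (n + 1)} := by
  induction n with
  | zero => simpa using hI
  | succ n ih =>
    calc I ^ (n + 1 + 1) = I ^ (n + 1) * I := pow_succ _ _
      _ ≤ (A * I ^ n ⊔ Ideal.span {y ^ (n + 1)}) * I := Ideal.mul_mono_left ih
      _ = A * I ^ (n + 1) ⊔ Ideal.span {y ^ (n + 1)} * I := by
        rw [Ideal.sup_mul, mul_assoc, ← pow_succ]
      _ ≤ _ := by
        refine sup_le le_sup_left ?_
        have h : Ideal.span {y ^ (n + 1)} * I ≤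
            Ideal.span {y ^ (n + 1)} * (A ⊔ Ideal.span {y}) := Ideal.mul_mono_right hI
        refine h.trans ?_
        rw [Ideal.mul_sup]
        refine sup_le ?_ ?_
        · rw [mul_comm]
          exact le_sup_of_le_left (Ideal.mul_mono_right
            ((Ideal.span_singleton_le_iff_mem _).2 (Ideal.pow_mem_pow hy _)))
        · rw [Ideal.span_singleton_mul_span_singleton, ← pow_succ]
          exact le_sup_right

/-- Each replacement of a factor x by s costs a multiple of x - s whose cofactor still lies in I^n.
-/
theorem pow_mul_sub_pow_mul_mem {I : Ideal R} {x s : R} (hx : x ∈ I) (hs : s ∈ I) (n : ℕ) :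
    ∀ j ≤ n + 1, ∀ z ∈ I ^ (n + 1 - j),
      x ^ j * z - s ^ j * z ∈ Ideal.span {x - s} * I ^ n := by
  intro j
  induction j with
  | zero => intro _ z _; simp
  | succ j ih =>
    intro hj z hz
    have h1 := ih (by omega) (x * z) (by
      rw [show n + 1 - j = (n + 1 - (j + 1)) + 1 by omega, pow_succ']
      exact Ideal.mul_mem_mul hx hz)
    have h2 : (x - s) * (s ^ j * z) ∈ Ideal.span {x - s} * I ^ n := by
      refine Ideal.mul_mem_mul (Ideal.mem_span_singleton_self _) ?_
      rw [show I ^ n = I ^ j * I ^ (n + 1 - (j + 1)) by rw [← pow_add]; congr 1; omega]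
      refine Ideal.mul_mem_mul (Ideal.pow_mem_pow hs j) ?_
      exact hz
    convert add_mem h1 h2 using 1
    ring

variable [IsLocalRing R]

/-- Any `c + 1` elements of `J`, where `c` is the colength of a regular principal ideal, are
linearly dependent modulo `𝔪 J`. -/
theorem exists_mem_span_sup_maximalIdeal_mul {a : R} (ha : a ∈ nonZeroDivisors R)
    (ham : a ∈ maximalIdeal R) (hfa : FiniteColength (Ideal.span {a})) {J : Ideal R}
    (hJ : FiniteColength J) {u : ℕ → R} (hu : ∀ i, i ≤ colength (Ideal.span {a}) → u i ∈ J) :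
    ∃ i ≤ colength (Ideal.span {a}),
      u i ∈ Ideal.span (u '' Set.Iio i) ⊔ maximalIdeal R * J := by
  by_contra! hcon
  set c := colength (Ideal.span {a})
  -- J/𝔪J is a quotient of J/aJ, which has length c; it has no room for the c + 1 strict steps that
  -- independent elements would give.
  have hle : Ideal.span {a} * J ≤ maximalIdeal R * J :=
    Ideal.mul_mono_left ((Ideal.span_singleton_le_iff_mem _).2 ham)
  have hfin := hfa.span_mul ha hJ
  let f : ℕ → Ideal R := fun i => Ideal.span (u '' Set.Iio i) ⊔ maximalIdeal R * J
  have hf0 : f 0 = maximalIdeal R * J := by simp [f]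
  have hmono : ∀ i, f i ≤ f (i + 1) := fun i =>
    sup_le_sup_right (Ideal.span_mono (Set.image_mono (Set.Iio_subset_Iio (by omega)))) _
  have h := FiniteColength.colength_add_le (f := f) (p := c + 1) (hf0 ▸ hfin.mono hle)
    (fun i hi => lt_of_le_of_ne (hmono i) fun heq => hcon i (by omega) (by
      change u i ∈ f i
      rw [heq]
      exact Ideal.mem_sup_left (Ideal.subset_span ⟨i, by simp, rfl⟩)))
  have hJle : f (c + 1) ≤ J := by
    refine sup_le (Ideal.span_le.2 ?_) Ideal.mul_le_right
    rintro _ ⟨i, hi, rfl⟩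
    exact hu i (by simp at hi; omega)
  have h1 := h.1.colength_le hJle
  have h2 := hfin.colength_le hle
  rw [colength_span_mul ha hfa hJ] at h2
  rw [hf0] at h
  omega

theorem exists_isUnit_eval_of_monic [Infinite (ResidueField R)] {p : R[X]} (hp : p.Monic) :
    ∃ t : R, IsUnit (p.eval t) := by
  have hp' : (p.map (residue R)) ≠ 0 := (hp.map _).ne_zero
  obtain ⟨t, ht⟩ := Polynomial.exists_eval_ne_zero_of_natDegree_lt_card _ hp' (by
    exact lt_of_lt_of_le (Cardinal.natCast_lt_aleph0) (Cardinal.aleph0_le_mk _))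
  obtain ⟨t, rfl⟩ := residue_surjective t
  refine ⟨t, ?_⟩
  rw [eval_map_apply] at ht
  rwa [residue_ne_zero_iff_isUnit] at ht

/-- Two generators of an ideal can be replaced by a single linear combination of them up to
passing to a reduction. -/
theorem exists_pow_mem_of_mem [Infinite (ResidueField R)] {a : R} (ha : a ∈ nonZeroDivisors R)
    (ham : a ∈ maximalIdeal R) (hfa : FiniteColength (Ideal.span {a})) {I : Ideal R}
    (hI : ∀ n, FiniteColength (I ^ n)) {x y : R} (hx : x ∈ I) (hy : y ∈ I) :
    ∃ t : R, ∃ n : ℕ,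
      y ^ (n + 1) ∈ Ideal.span {x - t * y} * I ^ n ⊔ maximalIdeal R * I ^ (n + 1) := by
  set c := colength (Ideal.span {a})
  obtain ⟨i, hic, hi⟩ := exists_mem_span_sup_maximalIdeal_mul ha ham hfa (hI (c + 1))
    (u := fun j => x ^ j * y ^ (c + 1 - j)) (by
      intro i hi
      have := Ideal.mul_mem_mul (Ideal.pow_mem_pow hx i) (Ideal.pow_mem_pow hy (c + 1 - i))
      rwa [← pow_add, show i + (c + 1 - i) = c + 1 by omega] at this)
  obtain ⟨v, hv, w, hw, hvw⟩ := Submodule.mem_sup.1 hi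
  rw [← Finset.coe_range, Submodule.mem_span_image_finset_iff_exists_fun'] at hv
  obtain ⟨b, hb⟩ := hv
  have hp : x ^ i * y ^ (c + 1 - i) -
      ∑ j ∈ Finset.range i, b j * (x ^ j * y ^ (c + 1 - j)) ∈ maximalIdeal R * I ^ (c + 1) := by
    rw [← hvw, ← hb]
    simpa using hw
  -- The dependence among the monomials in x and y, dehomogenized. The last monomial involved has
  -- coefficient 1, so the polynomial is monic.
  have hmon : (X ^ i - ∑ j ∈ Finset.range i, C (b j) * X ^ j).Monic := by
    refine monic_X_pow_sub (lt_of_le_of_lt (degree_sum_le _ _)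
      ((Finset.sup_lt_iff (WithBot.bot_lt_coe i)).2 fun j hj => ?_))
    exact lt_of_le_of_lt (degree_C_mul_X_pow_le _ _) (WithBot.coe_lt_coe.2 (Finset.mem_range.1 hj))
  obtain ⟨t, ht⟩ := exists_isUnit_eval_of_monic hmon
  refine ⟨t, c, ?_⟩
  have hty : t * y ∈ I := Ideal.mul_mem_left _ _ hy
  have hmem : ∀ j ≤ c + 1, x ^ j * y ^ (c + 1 - j) - t ^ j * y ^ (c + 1) ∈
      Ideal.span {x - t * y} * I ^ c := by
    intro j hj
    have := pow_mul_sub_pow_mul_mem hx hty c j hj _ (Ideal.pow_mem_pow hy (c + 1 - j))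
    rwa [mul_pow, mul_assoc, ← pow_add, show j + (c + 1 - j) = c + 1 by omega] at this
  -- Modulo (x - ty)I^c, x may be replaced by ty, and the relation becomes the value of the
  -- polynomial at t times y^(c+1).
  have h1 : (X ^ i - ∑ j ∈ Finset.range i, C (b j) * X ^ j).eval t * y ^ (c + 1) ∈
      Ideal.span {x - t * y} * I ^ c ⊔ maximalIdeal R * I ^ (c + 1) := by
    have h2 : x ^ i * y ^ (c + 1 - i) - t ^ i * y ^ (c + 1) -
        ∑ j ∈ Finset.range i, b j * (x ^ j * y ^ (c + 1 - j) - t ^ j * y ^ (c + 1)) ∈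
        Ideal.span {x - t * y} * I ^ c :=
      sub_mem (hmem i (by omega)) (sum_mem fun j hj => Ideal.mul_mem_left _ _
        (hmem j (by simp at hj; omega)))
    convert sub_mem (Ideal.mem_sup_right hp) (Ideal.mem_sup_left h2) using 1
    simp only [eval_sub, eval_X_pow, eval_finsetSum, eval_C_mul]
    simp only [mul_sub, Finset.sum_sub_distrib, sub_mul, Finset.sum_mul, mul_assoc]
    ring
  exact (Ideal.unit_mul_mem_iff_mem _ ht).1 h1

variable [IsNoetherianRing R]

/-- Since I^(n+1) is contained in AI^n + (y^(n+1)), the hypothesis on y puts it in AI^n + 𝔪I^(n+1),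
and Nakayama removes the second term. -/
theorem pow_succ_eq_of_pow_mem {A I : Ideal R} (hA : A ≤ I) {y : R} (hyI : y ∈ I)
    (hI : I ≤ A ⊔ Ideal.span {y}) {n : ℕ}
    (hy : y ^ (n + 1) ∈ A * I ^ n ⊔ maximalIdeal R * I ^ (n + 1)) : I ^ (n + 1) = A * I ^ n := by
  refine le_antisymm ?_ ?_
  · refine Submodule.le_of_le_smul_of_le_jacobson_bot (I := maximalIdeal R)
      (IsNoetherian.noetherian _) (IsLocalRing.jacobson_eq_maximalIdeal _ bot_ne_top).ge ?_
    refine (pow_succ_le_mul_pow_sup_span A I hyI hI n).trans (sup_le le_sup_left ?_)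
    rw [Ideal.span_singleton_le_iff_mem]
    exact hy
  · rw [pow_succ']
    exact Ideal.mul_mono_left hA

/-- An ideal of definition has a principal reduction. -/
theorem exists_principal_reduction_span [Infinite (ResidueField R)] {a : R}
    (ha : a ∈ nonZeroDivisors R) (ham : a ∈ maximalIdeal R)
    (hfa : FiniteColength (Ideal.span {a})) (N : ℕ) :
    ∀ s : Finset R, s.card ≤ N + 1 → (∃ p, maximalIdeal R ^ p ≤ Ideal.span (s : Set R)) →
      ∃ x ∈ Ideal.span (s : Set R), ∃ n : ℕ,
        Ideal.span (s : Set R) ^ (n + 1) = Ideal.span {x} * Ideal.span (s : Set R) ^ n := by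
  classical
  induction N with
  | zero =>
    intro s hs _
    rcases Nat.le_one_iff_eq_zero_or_eq_one.1 hs with h | h
    · rw [Finset.card_eq_zero] at h
      subst h
      exact ⟨0, zero_mem _, 0, by simp⟩
    · obtain ⟨x, rfl⟩ := Finset.card_eq_one.1 h
      exact ⟨x, by simp, 0, by simp⟩
  | succ N ih =>
    intro s hs hp
    by_cases hsN : s.card ≤ N + 1
    · exact ih s hsN hp
    obtain ⟨x, hx, y, hy, hxy⟩ := Finset.one_lt_card.1 (show 1 < s.card by omega)
    obtain ⟨p, hp⟩ := hp
    set I := Ideal.span (s : Set R) with hIdef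
    have hpow : ∀ n, maximalIdeal R ^ (p * n) ≤ I ^ n := fun n => by
      rw [pow_mul]
      exact Ideal.pow_right_mono hp n
    have hxI : x ∈ I := Ideal.subset_span hx
    have hyI : y ∈ I := Ideal.subset_span hy
    obtain ⟨t, n, ht⟩ := exists_pow_mem_of_mem ha ham hfa
      (fun n => finiteColength_of_maximalIdeal_pow_le (hpow n)) hxI hyI
    -- The two generators x and y are traded for x - ty, so the number of generators drops.
    set s' := insert (x - t * y) ((s.erase x).erase y) with hs'
    have hcard : s'.card ≤ N + 1 := by
      have h1 : s'.card ≤ _ := Finset.card_insert_le (x - t * y) ((s.erase x).erase y)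
      rw [Finset.card_erase_of_mem (Finset.mem_erase.2 ⟨hxy.symm, hy⟩),
        Finset.card_erase_of_mem hx] at h1
      omega
    set A := Ideal.span (s' : Set R) with hA
    have hwA : x - t * y ∈ A := Ideal.subset_span (by simp [hs'])
    have hAI : A ≤ I := by
      refine Ideal.span_le.2 fun z hz => ?_
      rw [hs', Finset.coe_insert, Set.mem_insert_iff] at hz
      rcases hz with rfl | hz
      · exact sub_mem hxI (Ideal.mul_mem_left _ _ hyI)
      · exact Ideal.subset_span (Finset.mem_of_mem_erase (Finset.mem_of_mem_erase hz))
    have hIA : I ≤ A ⊔ Ideal.span {y} := by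
      refine Ideal.span_le.2 fun z hz => ?_
      have hyA : y ∈ A ⊔ Ideal.span {y} :=
        Ideal.mem_sup_right (Ideal.mem_span_singleton_self y)
      by_cases hzy : z = y
      · exact hzy ▸ hyA
      by_cases hzx : z = x
      · have := add_mem (Ideal.mem_sup_left hwA : _ ∈ A ⊔ Ideal.span {y})
          (Ideal.mul_mem_left _ t hyA)
        rw [sub_add_cancel] at this
        exact hzx ▸ this
      · refine Ideal.mem_sup_left (Ideal.subset_span ?_)
        rw [hs', Finset.coe_insert]
        exact Set.mem_insert_of_mem _ (by
          rw [Finset.mem_coe, Finset.mem_erase, Finset.mem_erase]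
          exact ⟨hzy, hzx, hz⟩)
    have hred : I ^ (n + 1) = A * I ^ n := by
      have hle : Ideal.span {x - t * y} * I ^ n ≤ A * I ^ n :=
        Ideal.mul_mono_left ((Ideal.span_singleton_le_iff_mem _).2 hwA)
      exact pow_succ_eq_of_pow_mem hAI hyI hIA (sup_le_sup_right hle _ ht)
    obtain ⟨w, hw, m, hm⟩ := ih s' hcard ⟨p * (n + 1), (hpow _).trans (hred.trans_le Ideal.mul_le_left)⟩
    -- A reduction of the reduction A is a reduction of I: powers of I beyond n are powers of A
    -- times I^n.
    have hmul : ∀ j, I ^ (j + n) = A ^ j * I ^ n := by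
      intro j
      induction j with
      | zero => simp
      | succ j ihj =>
        rw [show j + 1 + n = j + (n + 1) by omega, pow_add, hred, mul_left_comm, ← pow_add, ihj,
          pow_succ', mul_assoc]
    refine ⟨w, hAI hw, m + n, ?_⟩
    rw [show m + n + 1 = m + 1 + n by omega, hmul, hm, mul_assoc, ← hmul]

end Reduction

/-! ### Generators of powers below the reduction number -/

section PowerFiltration

variable {R : Type*} [CommRing R] {I : Ideal R} {x : R}

theorem pow_succ_eq_span_mul_of_le {s n : ℕ} (hs : I ^ (s + 1) = Ideal.span {x} * I ^ s)
    (hn : s ≤ n) : I ^ (n + 1) = Ideal.span {x} * I ^ n := by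
  obtain ⟨m, rfl⟩ := Nat.exists_eq_add_of_le hn
  rw [show s + m + 1 = s + 1 + m by omega, pow_add, hs, mul_assoc, ← pow_add]

theorem pow_add_eq_span_pow_mul {s : ℕ} (hs : I ^ (s + 1) = Ideal.span {x} * I ^ s) (m : ℕ) :
    I ^ (s + m) = Ideal.span {x} ^ m * I ^ s := by
  induction m with
  | zero => simp
  | succ m ih =>
    rw [← add_assoc, pow_succ_eq_span_mul_of_le hs (by omega), ih, pow_succ', mul_assoc]

theorem le_of_span_pow_mul_le (hx : x ∈ nonZeroDivisors R) {A B : Ideal R} (m : ℕ)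
    (h : Ideal.span {x} ^ m * A ≤ Ideal.span {x} ^ m * B) : A ≤ B := by
  rw [Ideal.span_singleton_pow] at h
  intro a ha
  obtain ⟨b, hb, hab⟩ := Ideal.mem_span_singleton_mul.1
    (h (Ideal.mul_mem_mul (Ideal.mem_span_singleton_self _) ha))
  rw [mul_cancel_left_mem_nonZeroDivisors (pow_mem hx m)] at hab
  exact hab ▸ hb

variable [IsLocalRing R] [IsNoetherianRing R]

/-- If the filtration of `I ^ (i + 1 + d)` by the ideals `x ^ (i + 1 + d - j) I ^ j` stalls modulo
`𝔪` at `j = i`, then the reduction number with respect to `x` is at most `i`. -/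
theorem pow_succ_eq_of_span_mul_le_sup (hx : x ∈ nonZeroDivisors R) (hxI : x ∈ I) {s : ℕ}
    (hs : I ^ (s + 1) = Ideal.span {x} * I ^ s) {i d : ℕ}
    (h : Ideal.span {x} ^ d * I ^ (i + 1) ≤
      Ideal.span {x} ^ (d + 1) * I ^ i ⊔ maximalIdeal R * I ^ (i + 1 + d)) :
    I ^ (i + 1) = Ideal.span {x} * I ^ i := by
  have hxle : Ideal.span {x} ≤ I := (Ideal.span_singleton_le_iff_mem _).2 hxI
  -- Multiplying the stall by further powers of I propagates it, until the left side becomes a full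
  -- power of I and Nakayama applies.
  have key : ∀ j, Ideal.span {x} ^ d * I ^ (i + 1 + j) ≤
      Ideal.span {x} ^ (d + 1 + j) * I ^ i ⊔ maximalIdeal R * I ^ (i + 1 + d + j) := by
    intro j
    induction j with
    | zero => simpa using h
    | succ j ih =>
      calc Ideal.span {x} ^ d * I ^ (i + 1 + (j + 1))
          = Ideal.span {x} ^ d * I ^ (i + 1 + j) * I := by
            rw [← add_assoc, pow_succ, mul_assoc]
        _ ≤ (Ideal.span {x} ^ (d + 1 + j) * I ^ i ⊔
              maximalIdeal R * I ^ (i + 1 + d + j)) * I := Ideal.mul_mono_left ih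
        _ = Ideal.span {x} ^ (j + 1) * (Ideal.span {x} ^ d * I ^ (i + 1)) ⊔
              maximalIdeal R * I ^ (i + 1 + d + (j + 1)) := by
            rw [Ideal.sup_mul]
            congr 1 <;> ring
        _ ≤ Ideal.span {x} ^ (j + 1) * (Ideal.span {x} ^ (d + 1) * I ^ i ⊔
              maximalIdeal R * I ^ (i + 1 + d)) ⊔
              maximalIdeal R * I ^ (i + 1 + d + (j + 1)) :=
            sup_le_sup_right (Ideal.mul_mono_right h) _
        _ ≤ _ := by
            rw [Ideal.mul_sup]
            refine sup_le (sup_le (le_sup_of_le_left (le_of_eq (by ring))) ?_) le_sup_right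
            refine le_sup_of_le_right ?_
            calc Ideal.span {x} ^ (j + 1) * (maximalIdeal R * I ^ (i + 1 + d))
                ≤ I ^ (j + 1) * (maximalIdeal R * I ^ (i + 1 + d)) :=
                  Ideal.mul_mono_left (Ideal.pow_right_mono hxle _)
              _ = _ := by ring
  have h1 := key s
  have h2 : Ideal.span {x} ^ d * I ^ (i + 1 + s) = I ^ (i + 1 + d + s) := by
    rw [show i + 1 + d + s = s + (i + 1) + d by omega, show i + 1 + s = s + (i + 1) by omega,
      pow_add_eq_span_pow_mul (pow_succ_eq_span_mul_of_le hs (le_refl s)),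
      add_assoc, pow_add_eq_span_pow_mul hs, pow_add]
    ring
  rw [h2] at h1
  have h3 : I ^ (i + 1 + d + s) ≤ Ideal.span {x} ^ (d + 1 + s) * I ^ i :=
    Submodule.le_of_le_smul_of_le_jacobson_bot (I := maximalIdeal R)
      (IsNoetherian.noetherian _) (IsLocalRing.jacobson_eq_maximalIdeal _ bot_ne_top).ge h1
  refine le_antisymm (le_of_span_pow_mul_le hx (d + s) ?_) ?_
  · calc Ideal.span {x} ^ (d + s) * I ^ (i + 1) ≤ I ^ (d + s) * I ^ (i + 1) :=
          Ideal.mul_mono_left (Ideal.pow_right_mono hxle _)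
      _ = I ^ (i + 1 + d + s) := by ring
      _ ≤ _ := h3
      _ = _ := by ring
  · rw [pow_succ']
    exact Ideal.mul_mono_left hxle

/-- Up to the reduction number, `I ^ n` needs at least `n + 1` generators. -/
theorem colength_pow_add_le_colength_maximalIdeal_mul_pow (hx : x ∈ nonZeroDivisors R)
    (hxI : x ∈ I) {s : ℕ} (hs : I ^ (s + 1) = Ideal.span {x} * I ^ s) {n : ℕ}
    (hn : ∀ i < n, I ^ (i + 1) ≠ Ideal.span {x} * I ^ i)
    (hfin : FiniteColength (maximalIdeal R * I ^ n)) :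
    colength (I ^ n) + (n + 1) ≤ colength (maximalIdeal R * I ^ n) := by
  have hxle : Ideal.span {x} ≤ I := (Ideal.span_singleton_le_iff_mem _).2 hxI
  -- The index is shifted by one so that the chain starts at 𝔪I^n; its n + 1 steps end at I^n.
  let f : ℕ → Ideal R := fun j => match j with
    | 0 => maximalIdeal R * I ^ n
    | j + 1 => Ideal.span {x} ^ (n - j) * I ^ j ⊔ maximalIdeal R * I ^ n
  have hlast : f (n + 1) = I ^ n := by
    simp [f, Ideal.mul_le_right]
  have h := (FiniteColength.colength_add_le (f := f) (p := n + 1) hfin ?_).2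
  · rwa [hlast] at h
  intro i hi
  cases i with
  | zero =>
    -- If x^n were in 𝔪I^n, then I^(s+n) = x^n I^s would lie in 𝔪I^(s+n) and vanish, although it
    -- contains the nonzero element x^(s+n).
    refine lt_of_le_of_ne le_sup_right fun heq => ?_
    have h1 : Ideal.span {x} ^ n ≤ maximalIdeal R * I ^ n := by
      have h1 : Ideal.span {x} ^ (n - 0) * I ^ 0 ≤ f 0 := le_sup_left.trans heq.ge
      simpa using h1
    have h2 : I ^ (s + n) ≤ ⊥ := by
      refine Submodule.le_of_le_smul_of_le_jacobson_bot (I := maximalIdeal R)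
        (IsNoetherian.noetherian _) (IsLocalRing.jacobson_eq_maximalIdeal _ bot_ne_top).ge ?_
      rw [bot_sup_eq]
      calc I ^ (s + n) = Ideal.span {x} ^ n * I ^ s := pow_add_eq_span_pow_mul hs n
        _ ≤ maximalIdeal R * I ^ n * I ^ s := Ideal.mul_mono_left h1
        _ = maximalIdeal R * I ^ (s + n) := by ring
    have h3 : x ^ (s + n) = 0 := by simpa using h2 (Ideal.pow_mem_pow hxI _)
    exact nonZeroDivisors.ne_zero (pow_mem hx (s + n)) h3
  | succ i =>
    have hi' : i < n := by omega
    obtain ⟨d, rfl⟩ := Nat.exists_eq_add_of_le (Nat.succ_le_of_lt hi')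
    have e1 : i + 1 + d - i = d + 1 := by omega
    have e2 : i + 1 + d - (i + 1) = d := by omega
    change Ideal.span {x} ^ (i + 1 + d - i) * I ^ i ⊔ maximalIdeal R * I ^ (i + 1 + d) <
      Ideal.span {x} ^ (i + 1 + d - (i + 1)) * I ^ (i + 1) ⊔ maximalIdeal R * I ^ (i + 1 + d)
    rw [e1, e2]
    refine lt_of_le_of_ne (sup_le_sup_right ?_ _) fun heq => hn i hi' ?_
    · rw [pow_succ, mul_assoc, pow_succ' I]
      exact Ideal.mul_mono_right (Ideal.mul_mono_left hxle)
    · exact pow_succ_eq_of_span_mul_le_sup hx hxI hs (le_sup_left.trans heq.ge)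

/-- Lower bound for the length of `I ^ n / I ^ (n + 1)` below the reduction number, given a chain of
integrally closed ideals from an ideal containing `I` to the maximal ideal. -/
theorem colength_pow_add_le_colength_mul_pow (hx : x ∈ nonZeroDivisors R)
    (hxI : x ∈ I) {s : ℕ} (hs : I ^ (s + 1) = Ideal.span {x} * I ^ s) {n : ℕ}
    (hn : ∀ i < n, I ^ (i + 1) ≠ Ideal.span {x} * I ^ i)
    (hfin : FiniteColength (I ^ (n + 1))) {k : ℕ} {K : ℕ → Ideal R} (hK0 : I ≤ K 0)
    (hKk : K k = maximalIdeal R) (hKclosed : ∀ i < k, IsIntegrallyClosedIdeal (K i))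
    (hKlt : ∀ i < k, K i < K (i + 1)) :
    colength (I ^ n) + (n + 1) + k ≤ colength (K 0 * I ^ n) := by
  have hfin0 : FiniteColength (K 0 * I ^ n) := by
    refine hfin.mono ?_
    rw [pow_succ']
    exact Ideal.mul_mono_left hK0
  -- I^n contains the regular element x^n, so the chain K stays strict after multiplication by I^n.
  obtain ⟨h1, h2⟩ := FiniteColength.colength_add_le (f := fun i => K i * I ^ n) (p := k) hfin0
    fun i hi => (hKclosed i hi).mul_lt_mul (IsNoetherian.noetherian _)
      (Ideal.pow_mem_pow hxI n) (pow_mem hx n) (hKlt i hi)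
  simp only [hKk] at h1 h2
  have := colength_pow_add_le_colength_maximalIdeal_mul_pow hx hxI hs hn h1
  omega

end PowerFiltration

/-! ### Dimension one: reductions, Hilbert coefficients and the inequality -/

theorem two_mul_choose_two (z : ℤ) : 2 * Ring.choose z 2 = z * (z - 1) := by
  have h := Ring.descPochhammer_eq_factorial_smul_choose z 2
  rw [descPochhammer_succ_right, descPochhammer_one, ← aeval_eq_smeval] at h
  simpa [Nat.factorial] using h.symm

section Local

variable {R : Type*} [CommRing R] [IsNoetherianRing R] [IsLocalRing R]

theorem IsCohenMacaulayLocal.exists_finiteColength_span (hCM : IsCohenMacaulayLocal R)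
    (hdim : ringKrullDim R = 1) :
    ∃ a ∈ maximalIdeal R, a ∈ nonZeroDivisors R ∧ FiniteColength (Ideal.span {a}) := by
  obtain ⟨rs, hm, hreg, hlen⟩ := hCM
  rw [hdim] at hlen
  have hlen' : rs.length = 1 := by exact_mod_cast hlen
  obtain ⟨a, rfl⟩ := List.length_eq_one_iff.1 hlen'
  have ha : IsSMulRegular R a := ((RingTheory.Sequence.isRegular_cons_iff R a []).1 hreg).1
  have hanz : a ∈ nonZeroDivisors R := by
    rw [mem_nonZeroDivisors_iff_right]
    intro z hz
    refine ha ?_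
    simpa [mul_comm] using hz
  refine ⟨a, hm a (by simp), hanz, ?_⟩
  have h := ringKrullDim_quotient_succ_le_of_nonZeroDivisor hanz
  rw [hdim] at h
  have hz : Ring.KrullDimLE 0 (R ⧸ Ideal.span {a}) := by
    rw [Ring.krullDimLE_iff]
    have : ringKrullDim (R ⧸ Ideal.span {a}) + 1 ≤ 0 + 1 := by simpa using h
    exact ENat.WithBot.add_le_add_one_right_iff.1 this
  exact finiteColength_of_isArtinianRing (isArtinianRing_iff_krullDimLE_zero.2 hz)

theorem IsMaximalPrimary.exists_pow_le {I : Ideal R} (hI : IsMaximalPrimary I) :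
    ∃ p, maximalIdeal R ^ p ≤ I :=
  Ideal.exists_pow_le_of_le_radical_of_fg hI.2.ge (IsNoetherian.noetherian _)

/-- In a one-dimensional Cohen–Macaulay local ring with infinite residue field, every `𝔪`-primary
ideal has a principal reduction, generated by a regular element. -/
theorem exists_principal_reduction [Infinite (ResidueField R)] (hCM : IsCohenMacaulayLocal R)
    (hdim : ringKrullDim R = 1) {I : Ideal R} (hI : IsMaximalPrimary I) :
    ∃ x ∈ I, x ∈ nonZeroDivisors R ∧ FiniteColength (Ideal.span {x}) ∧
      ∃ s, I ^ (s + 1) = Ideal.span {x} * I ^ s := by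
  obtain ⟨a, ham, ha, hfa⟩ := hCM.exists_finiteColength_span hdim
  obtain ⟨p, hp⟩ := hI.exists_pow_le
  obtain ⟨S, rfl⟩ : I.FG := IsNoetherian.noetherian I
  obtain ⟨x, hxI, s, hs⟩ := exists_principal_reduction_span ha ham hfa S.card S (by omega) ⟨p, hp⟩
  -- A power of 𝔪 lies in I^(s+1), hence in (x). So (x) has finite colength, and a power of the
  -- regular element a is a multiple of x, which makes x regular.
  have hle : maximalIdeal R ^ (p * (s + 1)) ≤ Ideal.span {x} := by
    rw [pow_mul]
    exact (Ideal.pow_right_mono hp _).trans (hs.trans_le Ideal.mul_le_left)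
  refine ⟨x, hxI, ?_, finiteColength_of_maximalIdeal_pow_le hle, s, hs⟩
  obtain ⟨z, hz⟩ := Ideal.mem_span_singleton'.1 (hle (Ideal.pow_mem_pow ham _))
  have h := pow_mem ha (p * (s + 1))
  rw [← hz] at h
  exact (mul_mem_nonZeroDivisors.1 h).2

end Local

/-- From r on the colengths of the powers grow linearly with slope c. Two consecutive large values
determine both coefficients, which gives their uniqueness as well as their values. -/
theorem isHilbertCoefficients_one_iff {R : Type*} [CommRing R] {I : Ideal R}
    (hfin : ∀ n, FiniteColength (I ^ n)) {c r : ℕ}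
    (hr : ∀ n, r ≤ n → colength (I ^ (n + 1)) = colength (I ^ n) + c) (e : Fin (1 + 1) → ℤ) :
    IsHilbertCoefficients I 1 e ↔ e 0 = c ∧ e 1 = r * c - colength (I ^ r) := by
  have hlin : ∀ n, r ≤ n → (colength (I ^ n) : ℤ) = colength (I ^ r) + (n - r) * c := by
    intro n hn
    induction n, hn using Nat.le_induction with
    | base => simp
    | succ n hn ih =>
      rw [hr n hn]
      push_cast
      rw [ih]
      ring
  have hsum : ∀ n : ℕ, ∑ j : Fin (1 + 1), (-1) ^ (j : ℕ) * e j *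
      ((n + 1 - j).choose (1 - j) : ℤ) = e 0 * (n + 1) - e 1 := by
    intro n
    rw [Fin.sum_univ_two]
    simp
    ring
  unfold IsHilbertCoefficients
  simp only [hsum]
  constructor
  · intro h
    obtain ⟨N, hN⟩ := Filter.eventually_atTop.1 h
    have hval : ∀ n, N ≤ n → (colength (I ^ (n + 1)) : ℤ) = e 0 * (n + 1) - e 1 := by
      intro n hn
      obtain ⟨l, hl, hle⟩ := hN n hn
      rw [← (hfin _).coe_colength] at hl
      rw [← hle]
      exact_mod_cast hl
    have h1 := hval (N + r) (by omega)
    have h2 := hval (N + r + 1) (by omega)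
    rw [hr _ (by omega)] at h2
    have h0 := hlin (N + r + 1) (by omega)
    push_cast at h0 h1 h2
    have he : e 0 = c := by linarith
    refine ⟨he, ?_⟩
    rw [he] at h1
    linarith
  · rintro ⟨h0, h1⟩
    refine Filter.eventually_atTop.2 ⟨r, fun n hn => ⟨_, (hfin _).coe_colength.symm, ?_⟩⟩
    rw [hlin _ (by omega), h0, h1]
    push_cast
    ring

/-- The Hilbert coefficient inequality, in terms of a principal reduction `x` and a chain of
integrally closed ideals. -/
theorem mul_colength_sub_le_choose {R : Type*} [CommRing R] [IsNoetherianRing R] [IsLocalRing R]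
    {I : Ideal R} (hfin : ∀ n, FiniteColength (I ^ n)) {x : R} (hx : x ∈ nonZeroDivisors R)
    (hxI : x ∈ I) {r : ℕ} (hr : I ^ (r + 1) = Ideal.span {x} * I ^ r)
    (hrmin : ∀ i < r, I ^ (i + 1) ≠ Ideal.span {x} * I ^ i) {k : ℕ} {K : ℕ → Ideal R}
    (hK0 : I ≤ K 0) (hKk : K k = maximalIdeal R) (hKclosed : ∀ i < k, IsIntegrallyClosedIdeal (K i))
    (hKlt : ∀ i < k, K i < K (i + 1)) :
    (r * colength (Ideal.span {x}) - colength (I ^ r) : ℤ) ≤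
        Ring.choose (colength (Ideal.span {x}) - k : ℤ) 2 ∧
      (I < K 0 → (r * colength (Ideal.span {x}) - colength (I ^ r) : ℤ) <
        Ring.choose (colength (Ideal.span {x}) - k : ℤ) 2) := by
  have hstep : ∀ n ≤ r, colength (I ^ n) + (n + 1) + k ≤ colength (K 0 * I ^ n) := fun n hn =>
    colength_pow_add_le_colength_mul_pow hx hxI hr (fun i hi => hrmin i (by omega)) (hfin _)
      hK0 hKk hKclosed hKlt
  have hstep' : ∀ n ≤ r, colength (I ^ n) + (n + 1) + k ≤ colength (I ^ (n + 1)) := fun n hn => by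
    refine (hstep n hn).trans ((hfin _).colength_le ?_)
    rw [pow_succ']
    exact Ideal.mul_mono_left hK0
  have hchoose := two_mul_choose_two (colength (Ideal.span {x}) - k : ℤ)
  set E : ℤ := (colength (Ideal.span {x}) - k : ℤ)
  have hc : (colength (Ideal.span {x}) : ℤ) = E + k := by simp [E]
  rw [hc]
  -- This is E(E-1) - (2rE - r(r+1)), twice the gap between the two bounds.
  have hnonneg : 0 ≤ (E - r) * (E - r - 1) := by
    rcases le_or_gt (E - r) 0 with h | h
    · exact mul_nonneg_of_nonpos_of_nonpos h (by linarith)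
    · exact mul_nonneg h.le (by linarith [Int.add_one_le_iff.2 h])
  constructor
  · have hsum : ∀ n ≤ r, (n * (n + 1 + 2 * k) : ℤ) ≤ 2 * colength (I ^ n) := by
      intro n
      induction n with
      | zero => intro _; simp
      | succ n ih =>
        intro hn
        have h1 := ih (by omega)
        have h2 : ((colength (I ^ n) + (n + 1) + k : ℕ) : ℤ) ≤ _ :=
          Int.ofNat_le.2 (hstep' n (by omega))
        push_cast at h2 ⊢
        linarith
    have := hsum r le_rfl
    linarith
  · intro hlt
    -- The step n = 0 gives λ(R/K 0) ≥ k + 1, and the strict inclusion of I in K 0 adds one.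
    have h0 : k + 2 ≤ colength I := by
      have h1 := hstep 0 (Nat.zero_le _)
      have h2 := (pow_one I ▸ hfin 1).colength_lt hlt
      simp only [pow_zero, Ideal.one_eq_top, Ideal.mul_top] at h1
      omega
    -- For r = 0 the sum is empty and the extra unit is lost from it; instead I = (x), so c ≥ k + 2
    -- and the binomial coefficient is positive while the left side is 0.
    rcases Nat.eq_zero_or_pos r with rfl | hrpos
    · have hIx : I = Ideal.span {x} := by simpa using hr
      rw [hIx] at h0
      have hE : 2 ≤ E := by omega
      have : 2 ≤ E * (E - 1) := by nlinarith
      push_cast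
      linarith [Int.natCast_nonneg (colength (I ^ 0))]
    · have hsum : ∀ n, 1 ≤ n → n ≤ r →
          (n * (n + 1 + 2 * k) + 2 : ℤ) ≤ 2 * colength (I ^ n) := by
        intro n hn
        induction n, hn using Nat.le_induction with
        | base => intro _; push_cast; rw [pow_one]; omega
        | succ n hn ih =>
          intro hnr
          have h1 := ih (by omega)
          have h2 : ((colength (I ^ n) + (n + 1) + k : ℕ) : ℤ) ≤ _ :=
            Int.ofNat_le.2 (hstep' n (by omega))
          push_cast at h2 ⊢
          linarith
      have := hsum r hrpos le_rfl
      linarith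

end HilbertCoeff

/-! ### Deduction of the theorem -/

theorem theorem2p1 {R : Type*} [CommRing R] [IsNoetherianRing R] [IsLocalRing R]
    [Infinite (IsLocalRing.ResidueField R)] (hCM : HilbertCoeff.IsCohenMacaulayLocal R)
    (hdim : ringKrullDim R = 1)
    (I : Ideal R) (hI : HilbertCoeff.IsMaximalPrimary I)
    (k : ℕ) (hk : 1 ≤ k) (J : Fin (k - 1) → Ideal R)
    (hJclosed : ∀ i, HilbertCoeff.IsIntegrallyClosedIdeal (J i))
    (hJdistinct : Function.Injective J) (hJchain : Monotone J)
    (hJlt : ∀ i, J i < IsLocalRing.maximalIdeal R)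
    (hltJ : ∀ i, HilbertCoeff.idealIntegralClosure I < J i)
    (hIlt : HilbertCoeff.idealIntegralClosure I < IsLocalRing.maximalIdeal R) :
    (∃! e : Fin (1 + 1) → ℤ, HilbertCoeff.IsHilbertCoefficients I 1 e) ∧
      ∀ e : Fin (1 + 1) → ℤ, HilbertCoeff.IsHilbertCoefficients I 1 e →
        e 1 ≤ Ring.choose (e 0 - (k : ℤ)) 2 ∧
        (¬ HilbertCoeff.IsIntegrallyClosedIdeal I → e 1 < Ring.choose (e 0 - (k : ℤ)) 2) := by
  classical
  obtain ⟨x, hxI, hx, hfx, hs⟩ := HilbertCoeff.exists_principal_reduction hCM hdim hI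
  obtain ⟨p, hp⟩ := hI.exists_pow_le
  have hfin : ∀ n, HilbertCoeff.FiniteColength (I ^ n) := fun n =>
    HilbertCoeff.finiteColength_of_maximalIdeal_pow_le (p := p * n)
      (by rw [pow_mul]; exact Ideal.pow_right_mono hp n)
  obtain ⟨r, hr, hrmin⟩ : ∃ r, I ^ (r + 1) = Ideal.span {x} * I ^ r ∧
      ∀ i < r, I ^ (i + 1) ≠ Ideal.span {x} * I ^ i :=
    ⟨Nat.find hs, Nat.find_spec hs, fun i hi => Nat.find_min hs hi⟩
  have hiff := HilbertCoeff.isHilbertCoefficients_one_iff hfin (c := HilbertCoeff.colength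
    (Ideal.span {x})) (r := r) fun n hn => by
      rw [HilbertCoeff.pow_succ_eq_span_mul_of_le hr hn,
        HilbertCoeff.colength_span_mul hx hfx (hfin n)]
  refine ⟨⟨![HilbertCoeff.colength (Ideal.span {x}),
    r * HilbertCoeff.colength (Ideal.span {x}) - HilbertCoeff.colength (I ^ r)],
    (hiff _).2 ⟨rfl, rfl⟩, fun e he => ?_⟩, fun e he => ?_⟩
  · obtain ⟨h0, h1⟩ := (hiff e).1 he
    funext i
    fin_cases i
    · exact h0
    · exact h1
  obtain ⟨h0, h1⟩ := (hiff e).1 he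
  -- The closure of I, the k - 1 ideals J and 𝔪 form one chain with k strict steps; `K (i + 1)` is
  -- `J i` because `J` is indexed from 0.
  let K : ℕ → Ideal R := fun i => if i = 0 then HilbertCoeff.idealIntegralClosure I else
    if h : i - 1 < k - 1 then J ⟨i - 1, h⟩ else IsLocalRing.maximalIdeal R
  have hK0 : K 0 = HilbertCoeff.idealIntegralClosure I := rfl
  have hKk : K k = IsLocalRing.maximalIdeal R := by
    simp only [K]
    rw [if_neg (by omega), dif_neg (by omega)]
  have hKJ : ∀ i (h : i < k - 1), K (i + 1) = J ⟨i, h⟩ := fun i h => by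
    simp only [K]
    rw [if_neg (by omega), dif_pos (by omega)]
    rfl
  have hKclosed : ∀ i < k, HilbertCoeff.IsIntegrallyClosedIdeal (K i) := by
    intro i hi
    cases i with
    | zero => exact HilbertCoeff.isIntegrallyClosedIdeal_idealIntegralClosure I
    | succ i =>
      rw [hKJ i (by omega)]
      exact hJclosed _
  have hKlt : ∀ i < k, K i < K (i + 1) := by
    intro i hi
    rcases Nat.lt_or_ge (i + 1) k with hik | hik
    · rw [hKJ i (by omega)]
      cases i with
      | zero => exact hltJ _
      | succ i =>
        rw [hKJ i (by omega)]
        exact hJchain.strictMono_of_injective hJdistinct (Fin.mk_lt_mk.2 (Nat.lt_succ_self i))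
    · rw [show i + 1 = k by omega, hKk]
      cases i with
      | zero => exact hIlt
      | succ i =>
        rw [hKJ i (by omega)]
        exact hJlt _
  have hle : I ≤ K 0 := HilbertCoeff.le_idealIntegralClosure I
  have hmain := HilbertCoeff.mul_colength_sub_le_choose hfin hx hxI hr hrmin hle hKk hKclosed hKlt
  rw [h0, h1]
  exact ⟨hmain.1, fun hnot => hmain.2 (lt_of_le_of_ne hle fun h => hnot (hK0.symm.trans h.symm))⟩
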